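/- There are universal constants $c_0,c_1,C>0$ such that the following holds. Let $Z_1,\dots,Z_n$ ($n\ge 1$) be i.i.d. copies of a random element $Z$, let $X=X(Z)$ be a random vector in $\mathbb{R}^p$, and let $m(Z;g)$ be linear in the function $g:\mathbb{R}^p\to\mathbb{R}$. Let $s\ge 1$, $\gamma,\lambda>0$, and $0<\zeta<1$ with $2\zeta\le p$ (that is, $p\ge 2$, or $p=1$ and $\zeta\le 1/2$). Write $\mathcal{F}^i=\{x\mapsto x_i,\ x\mapsto -x_i\}$ and $\mathcal{F}=\bigcup_{i=1}^p\mathcal{F}^i$. Suppose that $a_0(x)=\langle\theta_0,x\rangle$ is the Riesz representer, i.e. $\mathbb{E}[m(Z;g)]=\mathbb{E}[a_0(X)g(X)]$ for every linear function $g$ on $\mathbb{R}^p$, that $\|\theta_0\|_0\le s$, and that almost surely $|f(X)|\le 1$ and $|m(Z;f)|\le 1$ for all $f\in\mathcal{F}$, and $|a_0(X)|\le 1$. Put $$\delta_{n,\zeta}:=2\max_{1\le i\le p}\bigl(\mathcal{R}(\mathcal{F}^i)+\mathcal{R}(m\circ\mathcal{F}^i)\bigr)+c_0\sqrt{\frac{\log(c_1p/\zeta)}{n}},$$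 where $m\circ\mathcal{F}^i=\{m(\cdot;f):f\in\mathcal{F}^i\}$ and, for a class $\mathcal{H}$ of functions of $Z$, $\mathcal{R}(\mathcal{H})=\mathbb{E}\bigl[\sup_{h\in\mathcal{H}}\frac1n\sum_{k=1}^n\epsilon_k h(Z_k)\bigr]$ with independent uniform signs $\epsilon_k\in\{-1,1\}$, independent of $Z_1,\dots,Z_n$ (a function $f$ of $x$ is viewed as the function $f(X(\cdot))$ of $Z$). Let $S=\operatorname{supp}\theta_0$ and let $V=\mathbb{E}[XX^\top]$ satisfy the restricted eigenvalue condition $$\forall\,\nu\in\mathbb{R}^p\ \text{ with }\ \|\nu_{S^c}\|_1\le\|\nu_S\|_1+\delta_{n,\zeta}/\lambda:\qquad \nu^\top V\nu\ge\gamma\|\nu\|_2^2 .$$ Suppose $\delta_{n,\zeta}\le\lambda\le\frac{\gamma}{8s}$, and let $\hat a=\langle\hat\theta,\cdot\rangle$ where $\hat\theta$ is any minimizer over $\theta\in\mathbb{R}^p$ of $$\sup_{f\in\mathcal{F}}\ \frac1n\sum_{k=1}^n\bigl(m(Z_k;f)-\langle\theta,X_k\rangle f(X_k)\bigr)+\lambda\|\theta\|_1,\qquad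 X_k=X(Z_k).$$ Then with probability at least $1-\zeta$, $$\|\hat a-a_0\|_2\le C\,\max\Bigl\{1,\frac{1}{\lambda}\frac{\gamma}{s}\Bigr\}\sqrt{\frac{s}{\gamma}}\left((\|\theta_0\|_1+1)\sqrt{\frac{\log p}{n}}+\sqrt{\frac{\log(p/\zeta)}{n}}\right),$$ where $\|\hat a-a_0\|_2^2=\mathbb{E}_X[(\hat a(X)-a_0(X))^2]$, the expectation being over a draw of $X$ independent of the sample. -/

import Mathlib

open MeasureTheory ProbabilityTheory
open scoped Matrix

noncomputable section

namespace AdversarialRiesz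

/-- The linear function `x ↦ ⟨θ, x⟩` on `ℝ^p`. -/
def linFun {p : ℕ} (θ : Fin p → ℝ) : (Fin p → ℝ) → ℝ := fun x => θ ⬝ᵥ x

/-- The `ℓ₁` norm of a coefficient vector; this is `‖⟨θ, ·⟩‖_𝓐`. -/
def l1 {p : ℕ} (θ : Fin p → ℝ) : ℝ := ∑ i, |θ i|

/-- The support of a coefficient vector; its cardinality is `‖θ‖₀`. -/
def supp {p : ℕ} (θ : Fin p → ℝ) : Finset (Fin p) := Finset.univ.filter fun i => θ i ≠ 0

/-- The symmetric two-element class `𝓕ⁱ = {x ↦ x_i, x ↦ -x_i}`. -/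
def coordClass {p : ℕ} (i : Fin p) : Set ((Fin p → ℝ) → ℝ) :=
  {f | ∃ ξ ∈ ({-1, 1} : Set ℝ), f = fun x => ξ * x i}

/-- The class of test functions `𝓕 = ⋃ᵢ 𝓕ⁱ = {x ↦ ξ x_i : i ∈ [p], ξ ∈ {-1, 1}}`. -/
def testClass (p : ℕ) : Set ((Fin p → ℝ) → ℝ) := ⋃ i : Fin p, coordClass i

section Sample

variable {𝒵 : Type*} {p n : ℕ}

/-- The empirical criterion
`sup_{f ∈ 𝓕} 𝔼ₙ[m(Z; f) - a(X) f(X)] + λ ‖a‖_𝓐` at `a = ⟨θ, ·⟩`, on the sample `z`. -/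
def criterion (X : 𝒵 → Fin p → ℝ) (m : 𝒵 → ((Fin p → ℝ) → ℝ) →ₗ[ℝ] ℝ) (lam : ℝ)
    (z : Fin n → 𝒵) (θ : Fin p → ℝ) : ℝ :=
  sSup ((fun f : (Fin p → ℝ) → ℝ =>
      (1 / (n : ℝ)) * ∑ k, (m (z k) f - linFun θ (X (z k)) * f (X (z k)))) '' testClass p)
    + lam * l1 θ

/-- `⟨θ, ·⟩` is a minimizer of the empirical criterion over all linear functions. -/
def IsEstimate (X : 𝒵 → Fin p → ℝ) (m : 𝒵 → ((Fin p → ℝ) → ℝ) →ₗ[ℝ] ℝ) (lam : ℝ)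
    (z : Fin n → 𝒵) (θ : Fin p → ℝ) : Prop :=
  ∀ θ' : Fin p → ℝ, criterion X m lam z θ ≤ criterion X m lam z θ'

variable [MeasurableSpace 𝒵]

/-- The Rademacher complexity `𝔼[sup_{g ∈ G} (1/n) ∑ₖ εₖ g(Zₖ)]` of a class `G` of functions of
the observation, for `n` i.i.d. draws `Zₖ ∼ μ` and independent uniform signs `εₖ ∈ {-1, 1}`. -/
def rademacher (μ : Measure 𝒵) (n : ℕ) (G : Set (𝒵 → ℝ)) : ℝ :=
  ∫ z : Fin n → 𝒵,
    (1 / (2 : ℝ) ^ n) * ∑ ε : Fin n → ℤˣ,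
      sSup ((fun g : 𝒵 → ℝ => (1 / (n : ℝ)) * ∑ k, (((ε k : ℤˣ) : ℤ) : ℝ) * g (z k)) '' G)
    ∂(Measure.pi fun _ => μ)

/-- `δ_{n,ζ} = 2 maxᵢ (𝓡(𝓕ⁱ) + 𝓡(m ∘ 𝓕ⁱ)) + c₀ √(log(c₁ p / ζ) / n)`. -/
def delta (c₀ c₁ : ℝ) (μ : Measure 𝒵) (X : 𝒵 → Fin p → ℝ)
    (m : 𝒵 → ((Fin p → ℝ) → ℝ) →ₗ[ℝ] ℝ) (n : ℕ) (ζ : ℝ) : ℝ :=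
  2 * (⨆ i : Fin p,
      (rademacher μ n ((fun f z => f (X z)) '' coordClass i)
        + rademacher μ n ((fun f z => m z f) '' coordClass i)))
    + c₀ * √(Real.log (c₁ * p / ζ) / n)

/-- The (uncentred) covariance matrix `V = 𝔼[x x']`. -/
def covMatrix (μ : Measure 𝒵) (X : 𝒵 → Fin p → ℝ) : Matrix (Fin p) (Fin p) ℝ :=
  Matrix.of fun i j => ∫ z, X z i * X z j ∂μ

/-- The root mean squared distance `‖⟨θ, ·⟩ - ⟨θ', ·⟩‖₂` under the law of `X`. -/
def l2Dist (μ : Measure 𝒵) (X : 𝒵 → Fin p → ℝ) (θ θ' : Fin p → ℝ) : ℝ :=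
  √(∫ z, (linFun θ (X z) - linFun θ' (X z)) ^ 2 ∂μ)

end Sample

/-- Restricted eigenvalue condition: `ν' V ν ≥ γ ‖ν‖₂²` for all `ν` with
`‖ν_{Sᶜ}‖₁ ≤ ‖ν_S‖₁ + r`. -/
def RestrictedEigenvalue {p : ℕ} (V : Matrix (Fin p) (Fin p) ℝ) (S : Finset (Fin p))
    (r γ : ℝ) : Prop :=
  ∀ ν : Fin p → ℝ, ∑ i ∈ Sᶜ, |ν i| ≤ ∑ i ∈ S, |ν i| + r →
    γ * ∑ i, ν i ^ 2 ≤ ν ⬝ᵥ (V *ᵥ ν)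

end AdversarialRiesz

end

/-! Up to probability `ζ`, Hoeffding and a union bound put the `p` empirical moments at `θ₀`
(centred, by the Riesz property) and the `p²` empirical second moments within `r = 4 √(log(4p/ζ)/n)`
of their means. The rest is deterministic.

Let `ν = θhat - θ₀` have `ℓ₁` masses `a` on the support and `b` off it. Optimality against `θ₀`
gives `b ≤ a + r/λ`, so the restricted eigenvalue condition applies and `8 λ a² ≤ ν'Vν`. Conversely
`ν'Vν ≤ ‖ν‖₁ ‖Vν‖_∞`, where `Vν` is, up to `r ‖ν‖₁`, the difference of the residuals at `θ₀` and
`θhat`, both controlled by optimality. The two bounds on the quadratic form force `ν'Vν ≤ 18 r²/λ`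
(`dotProduct_mulVec_le_of_close`), which is stronger than the claimed rate (`sqrt_le_rate`). -/

namespace AdversarialRiesz

/-! ### Concentration of sample means. -/

section Concentration

/-- Hoeffding's inequality for the sample mean of a function with values in `[-2, 2]`. -/
lemma measureReal_le_sub_integral_le {𝒵 Ω : Type*} [MeasurableSpace 𝒵] {μ : Measure 𝒵}
    [IsProbabilityMeasure μ] [MeasurableSpace Ω] {P : Measure Ω} [IsProbabilityMeasure P]
    {n : ℕ} (hn : 1 ≤ n) {Z : Fin n → Ω → 𝒵} (hZ : ∀ k, Measurable (Z k))
    (hmap : ∀ k, P.map (Z k) = μ) (hind : iIndepFun Z P) {g : 𝒵 → ℝ} (hg : Measurable g)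
    (hb : ∀ᵐ z ∂μ, |g z| ≤ 2) {t : ℝ} (ht : 0 ≤ t) :
    P.real {ω | t ≤ (1 / (n : ℝ)) * ∑ k, g (Z k ω) - ∫ z, g z ∂μ}
      ≤ Real.exp (-(n * t ^ 2 / 8)) := by
  have hn0 : (0 : ℝ) < n := by exact_mod_cast hn
  -- The variance proxy 4 is the squared half-width of `[-2, 2]`.
  have hsub : HasSubgaussianMGF (fun z => g z - ∫ z, g z ∂μ) 4 μ := by
    have h := hasSubgaussianMGF_of_mem_Icc (μ := μ) (X := g) (a := -2) (b := 2) hg.aemeasurable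
      (by filter_upwards [hb] with z hz using abs_le.1 hz)
    convert h using 1
    ext
    simp only [NNReal.coe_pow, NNReal.coe_div, coe_nnnorm, Real.norm_eq_abs, NNReal.coe_ofNat]
    norm_num
  have hsubZ : ∀ k ∈ Finset.univ,
      HasSubgaussianMGF ((fun z => g z - ∫ z, g z ∂μ) ∘ Z k) 4 P := by
    intro k _
    exact HasSubgaussianMGF.of_map (hZ k).aemeasurable (by rw [hmap k]; exact hsub)
  have hindg := hind.comp (fun _ z => g z - ∫ z, g z ∂μ) (fun _ => hg.sub_const _)
  have h := HasSubgaussianMGF.measure_sum_ge_le_of_iIndepFun hindg (c := fun _ => 4) hsubZ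
    (ε := n * t) (by positivity)
  refine le_trans (le_of_eq ?_) (h.trans (le_of_eq ?_))
  · congr 1
    ext ω
    simp only [Set.mem_ofPred_eq, Function.comp_apply, Finset.sum_sub_distrib, Finset.sum_const,
      Finset.card_univ, Fintype.card_fin, nsmul_eq_mul]
    rw [← mul_le_mul_iff_right₀ hn0, mul_sub, ← mul_assoc, mul_one_div_cancel hn0.ne', one_mul]
  · congr 1
    simp only [Finset.sum_const, Finset.card_univ, Fintype.card_fin, nsmul_eq_mul]
    push_cast
    field_simp
    ring

/-- Uniform deviation of the sample means of finitely many functions with values in `[-2, 2]`. -/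
lemma measureReal_exists_le_abs_sub_integral_le {𝒵 Ω ι : Type*} [Fintype ι] [MeasurableSpace 𝒵]
    {μ : Measure 𝒵} [IsProbabilityMeasure μ] [MeasurableSpace Ω] {P : Measure Ω}
    [IsProbabilityMeasure P] {n : ℕ} (hn : 1 ≤ n) {Z : Fin n → Ω → 𝒵}
    (hZ : ∀ k, Measurable (Z k)) (hmap : ∀ k, P.map (Z k) = μ) (hind : iIndepFun Z P)
    {g : ι → 𝒵 → ℝ} (hg : ∀ i, Measurable (g i)) (hb : ∀ i, ∀ᵐ z ∂μ, |g i z| ≤ 2)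
    {t : ℝ} (ht : 0 ≤ t) :
    P.real {ω | ∃ i, t ≤ |(1 / (n : ℝ)) * ∑ k, g i (Z k ω) - ∫ z, g i z ∂μ|}
      ≤ Fintype.card ι * (2 * Real.exp (-(n * t ^ 2 / 8))) := by
  have hsingle : ∀ i, P.real {ω | t ≤ |(1 / (n : ℝ)) * ∑ k, g i (Z k ω) - ∫ z, g i z ∂μ|}
      ≤ 2 * Real.exp (-(n * t ^ 2 / 8)) := by
    intro i
    have h₁ := measureReal_le_sub_integral_le hn hZ hmap hind (hg i) (hb i) ht
    have h₂ := measureReal_le_sub_integral_le hn hZ hmap hind (g := fun z => -g i z) (hg i).neg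
      (by simpa using hb i) ht
    calc _ ≤ P.real ({ω | t ≤ (1 / (n : ℝ)) * ∑ k, g i (Z k ω) - ∫ z, g i z ∂μ} ∪
            {ω | t ≤ (1 / (n : ℝ)) * ∑ k, -g i (Z k ω) - ∫ z, -g i z ∂μ}) := by
          refine measureReal_mono ?_
          intro ω hω
          simp only [Set.mem_ofPred_eq, Set.mem_union, Finset.sum_neg_distrib, integral_neg] at hω ⊢
          rcases le_abs.1 hω with h | h
          · exact Or.inl h
          · right; linarith
      _ ≤ _ := (measureReal_union_le _ _).trans (by linarith)
  have hset : {ω | ∃ i, t ≤ |(1 / (n : ℝ)) * ∑ k, g i (Z k ω) - ∫ z, g i z ∂μ|}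
      = ⋃ i ∈ Finset.univ, {ω | t ≤ |(1 / (n : ℝ)) * ∑ k, g i (Z k ω) - ∫ z, g i z ∂μ|} := by
    ext ω; simp
  rw [hset]
  refine (measureReal_biUnion_finset_le _ _).trans
    ((Finset.sum_le_sum fun i _ => hsingle i).trans ?_)
  simp

end Concentration

/-! ### Lower bound on `delta`. -/

section Complexity

variable {𝒵 : Type*} [MeasurableSpace 𝒵] {p n : ℕ}

/-- For each sign pattern, one of `g` and `-g` has a nonnegative signed mean, so no boundedness or
integrability is needed. -/
lemma rademacher_nonneg (μ : Measure 𝒵) (n : ℕ) {G : Set (𝒵 → ℝ)} {g : 𝒵 → ℝ} (hg : g ∈ G)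
    (hg' : (fun z => -g z) ∈ G) : 0 ≤ rademacher μ n G := by
  refine integral_nonneg fun z => mul_nonneg (by positivity) (Finset.sum_nonneg fun ε _ => ?_)
  apply Real.sSup_nonneg'
  rcases le_total 0 ((1 / (n : ℝ)) * ∑ k, (((ε k : ℤˣ) : ℤ) : ℝ) * g (z k)) with h | h
  · exact ⟨_, ⟨g, hg, rfl⟩, h⟩
  · refine ⟨_, ⟨_, hg', rfl⟩, ?_⟩
    simp only [mul_neg, Finset.sum_neg_distrib]
    linarith

lemma coord_mem_coordClass (i : Fin p) : (fun x : Fin p → ℝ => x i) ∈ coordClass i :=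
  ⟨1, by simp, by simp⟩

lemma neg_coord_mem_coordClass (i : Fin p) : (fun x : Fin p → ℝ => -x i) ∈ coordClass i :=
  ⟨-1, by simp, by simp⟩

lemma coord_mem_testClass (i : Fin p) : (fun x : Fin p → ℝ => x i) ∈ testClass p :=
  Set.mem_iUnion.2 ⟨i, coord_mem_coordClass i⟩

lemma map_neg_coord (L : ((Fin p → ℝ) → ℝ) →ₗ[ℝ] ℝ) (i : Fin p) :
    L (fun x => -x i) = -L (fun x => x i) :=
  map_neg L (fun x => x i)

/-- The complexities enter the argument only through their sign: the logarithmic term of `delta`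
already dominates the deviations. -/
lemma le_delta {c₀ c₁ : ℝ} (μ : Measure 𝒵) (X : 𝒵 → Fin p → ℝ)
    (m : 𝒵 → ((Fin p → ℝ) → ℝ) →ₗ[ℝ] ℝ) (n : ℕ) (ζ : ℝ) :
    c₀ * √(Real.log (c₁ * p / ζ) / n) ≤ delta c₀ c₁ μ X m n ζ := by
  unfold delta
  refine le_add_of_nonneg_left (mul_nonneg zero_le_two (Real.iSup_nonneg fun i => add_nonneg ?_ ?_))
  · exact rademacher_nonneg μ n ⟨_, coord_mem_coordClass i, rfl⟩
      ⟨_, neg_coord_mem_coordClass i, rfl⟩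
  · exact rademacher_nonneg μ n ⟨_, coord_mem_coordClass i, rfl⟩
      ⟨_, neg_coord_mem_coordClass i, funext fun z => map_neg_coord (m z) i⟩

end Complexity

/-! ### The criterion as a maximum of absolute residuals plus the penalty. -/

section Criterion

variable {𝒵 : Type*} {p n : ℕ}

lemma testClass_finite (p : ℕ) : (testClass p).Finite := by
  refine Set.finite_iUnion fun i => Set.Finite.subset
    (((Set.finite_singleton (1 : ℝ)).insert (-1)).image fun ξ (x : Fin p → ℝ) => ξ * x i) ?_
  rintro f ⟨ξ, hξ, rfl⟩
  exact ⟨ξ, hξ, rfl⟩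

/-- The empirical moment violation of `⟨θ, ·⟩` in the direction of the `i`-th coordinate. -/
noncomputable def residual (X : 𝒵 → Fin p → ℝ) (m : 𝒵 → ((Fin p → ℝ) → ℝ) →ₗ[ℝ] ℝ) (z : Fin n → 𝒵)
    (θ : Fin p → ℝ) (i : Fin p) : ℝ :=
  (1 / (n : ℝ)) * ∑ k, (m (z k) (fun x => x i) - linFun θ (X (z k)) * X (z k) i)

lemma abs_residual_add_le_criterion (X : 𝒵 → Fin p → ℝ) (m : 𝒵 → ((Fin p → ℝ) → ℝ) →ₗ[ℝ] ℝ)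
    (lam : ℝ) (z : Fin n → 𝒵) (θ : Fin p → ℝ) (i : Fin p) :
    |residual X m z θ i| + lam * l1 θ ≤ criterion X m lam z θ := by
  refine add_le_add_left (abs_le'.2 ⟨?_, ?_⟩) _
  · exact le_csSup ((testClass_finite p).image _).bddAbove ⟨_, coord_mem_testClass i, rfl⟩
  · refine le_csSup ((testClass_finite p).image _).bddAbove
      ⟨_, Set.mem_iUnion.2 ⟨i, neg_coord_mem_coordClass i⟩, ?_⟩
    simp only [residual, map_neg_coord, ← mul_neg, ← Finset.sum_neg_distrib]
    congr 1
    exact Finset.sum_congr rfl fun k _ => by ring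

lemma criterion_le (X : 𝒵 → Fin p → ℝ) (m : 𝒵 → ((Fin p → ℝ) → ℝ) →ₗ[ℝ] ℝ)
    (lam : ℝ) (z : Fin n → 𝒵) (θ : Fin p → ℝ) {r : ℝ} (hr : 0 ≤ r)
    (h : ∀ i, |residual X m z θ i| ≤ r) : criterion X m lam z θ ≤ r + lam * l1 θ := by
  -- `0 ≤ r` covers the empty class at `p = 0`, whose `sSup` is 0.
  refine add_le_add_left (Real.sSup_le ?_ hr) _
  rintro _ ⟨f, hf, rfl⟩
  obtain ⟨i, ξ, hξ, rfl⟩ := Set.mem_iUnion.1 hf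
  have key : (1 / (n : ℝ)) * ∑ k, (m (z k) (fun x => ξ * x i)
      - linFun θ (X (z k)) * (ξ * X (z k) i)) = ξ * residual X m z θ i := by
    have hm : ∀ k, m (z k) (fun x => ξ * x i) = ξ * m (z k) (fun x => x i) := fun k =>
      map_smul (m (z k)) ξ (fun x => x i)
    simp only [residual, hm, mul_left_comm ξ, Finset.mul_sum]
    exact Finset.sum_congr rfl fun k _ => by ring
  have hi := abs_le.1 (h i)
  change (1 / (n : ℝ)) * ∑ k, (m (z k) (fun x => ξ * x i)
      - linFun θ (X (z k)) * (ξ * X (z k) i)) ≤ r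
  rw [key]
  rcases hξ with rfl | rfl <;> linarith

/-- The `m` terms cancel, leaving the empirical Gram matrix applied to the error. -/
lemma residual_sub_residual (X : 𝒵 → Fin p → ℝ) (m : 𝒵 → ((Fin p → ℝ) → ℝ) →ₗ[ℝ] ℝ)
    (z : Fin n → 𝒵) (θ θ' : Fin p → ℝ) (i : Fin p) :
    residual X m z θ' i - residual X m z θ i
      = ∑ j, (1 / (n : ℝ) * ∑ k, X (z k) i * X (z k) j) * (θ j - θ' j) := by
  have h : ∀ k, m (z k) (fun x => x i) - linFun θ' (X (z k)) * X (z k) i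
      - (m (z k) (fun x => x i) - linFun θ (X (z k)) * X (z k) i)
      = ∑ j, X (z k) i * X (z k) j * (θ j - θ' j) := by
    intro k
    simp only [linFun, dotProduct]
    rw [sub_sub_sub_cancel_left, ← sub_mul, ← Finset.sum_sub_distrib, Finset.sum_mul]
    exact Finset.sum_congr rfl fun j _ => by ring
  simp only [residual]
  rw [← mul_sub, ← Finset.sum_sub_distrib, Finset.sum_congr rfl fun k _ => h k,
    Finset.sum_comm, Finset.mul_sum]
  exact Finset.sum_congr rfl fun j _ => by rw [← Finset.sum_mul, mul_assoc]

end Criterion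

/-! ### Deterministic error bound. -/

section Deterministic

variable {p : ℕ}

lemma l1_sub_le {S : Finset (Fin p)} {θ θ₀ : Fin p → ℝ} (h : ∀ i ∉ S, θ₀ i = 0) :
    l1 θ₀ - l1 θ ≤ ∑ i ∈ S, |θ i - θ₀ i| - ∑ i ∈ Sᶜ, |θ i - θ₀ i| := by
  have h₁ : ∑ i ∈ S, (|θ₀ i| - |θ i|) ≤ ∑ i ∈ S, |θ i - θ₀ i| :=
    Finset.sum_le_sum fun i _ => by
      rw [abs_sub_comm]; exact abs_sub_abs_le_abs_sub _ _
  have h₂ : ∑ i ∈ Sᶜ, (|θ₀ i| - |θ i|) = -∑ i ∈ Sᶜ, |θ i - θ₀ i| := by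
    rw [← Finset.sum_neg_distrib]
    exact Finset.sum_congr rfl fun i hi => by simp [h i (Finset.mem_compl.1 hi)]
  have h₃ : l1 θ₀ - l1 θ = ∑ i ∈ S, (|θ₀ i| - |θ i|) + ∑ i ∈ Sᶜ, (|θ₀ i| - |θ i|) := by
    rw [Finset.sum_add_sum_compl, Finset.sum_sub_distrib]; rfl
  linarith

/-- `ℓ₁`–`ℓ_∞` duality twice: once for the quadratic form, once for the perturbation `W - V`. -/
lemma dotProduct_mulVec_le {V W : Matrix (Fin p) (Fin p) ℝ} {ν : Fin p → ℝ} {r B : ℝ}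
    (hVW : ∀ i j, |W i j - V i j| ≤ r) (hW : ∀ i, |∑ j, W i j * ν j| ≤ B) :
    ν ⬝ᵥ (V *ᵥ ν) ≤ l1 ν * (B + r * l1 ν) := by
  have hV : ∀ i, |∑ j, V i j * ν j| ≤ B + r * l1 ν := by
    intro i
    have h₁ : ∑ j, V i j * ν j = ∑ j, W i j * ν j - ∑ j, (W i j - V i j) * ν j := by
      rw [← Finset.sum_sub_distrib]
      exact Finset.sum_congr rfl fun j _ => by ring
    have h₂ : |∑ j, (W i j - V i j) * ν j| ≤ r * l1 ν := by
      rw [l1, Finset.mul_sum]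
      refine (Finset.abs_sum_le_sum_abs _ _).trans (Finset.sum_le_sum fun j _ => ?_)
      rw [abs_mul]
      exact mul_le_mul_of_nonneg_right (hVW i j) (abs_nonneg _)
    rw [h₁]
    exact (abs_sub _ _).trans (add_le_add (hW i) h₂)
  calc ν ⬝ᵥ (V *ᵥ ν) = ∑ i, ν i * ∑ j, V i j * ν j := rfl
    _ ≤ ∑ i, |ν i| * (B + r * l1 ν) := Finset.sum_le_sum fun i _ => by
        refine (le_abs_self _).trans ?_
        rw [abs_mul]
        exact mul_le_mul_of_nonneg_left (hV i) (abs_nonneg _)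
    _ = _ := by rw [← Finset.sum_mul]; rfl

/-- Used with `q = ν'Vν/λ` and `y = r/λ`. Eliminating `b` bounds `q` by `3a² + 6ay + (9/4)y²`.
Against `8a² ≤ q` this gives `a ≤ 3y/2`, the positive root, where the bound equals `18y²`. -/
lemma le_of_quadratic_bound {q a b y : ℝ} (ha : 0 ≤ a) (hb : 0 ≤ b) (hy : 0 ≤ y)
    (hy' : y ≤ 1 / 4) (hba : b ≤ a + y) (hq : 8 * a ^ 2 ≤ q)
    (hq' : q ≤ (a + b) * (2 * y + (a - b) + y * (a + b))) : q ≤ 18 * y ^ 2 := by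
  have h₁ : (a + b) * (2 * y + (a - b) + y * (a + b))
      ≤ (2 * a + y) * (2 * y + a + (2 * a + y) / 4) := by
    have h₂ : 2 * y + (a - b) + y * (a + b) ≤ 2 * y + a + (2 * a + y) / 4 := by
      nlinarith [mul_nonneg (sub_nonneg.2 hy') (add_nonneg ha hb)]
    exact (mul_le_mul_of_nonneg_left h₂ (by positivity)).trans
      (mul_le_mul_of_nonneg_right (by linarith) (by positivity))
  have h₃ : a ≤ 3 / 2 * y := by
    by_contra! h
    nlinarith [mul_pos (sub_pos.2 h) (by linarith : 0 < a)]
  nlinarith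

/-- The fast rate on the event that the empirical moments and covariances are within `r` of
their population counterparts. -/
lemma dotProduct_mulVec_le_of_close {V W : Matrix (Fin p) (Fin p) ℝ} {θ θ₀ : Fin p → ℝ}
    {s : ℕ} {r δ lam γ : ℝ} {u u₀ : Fin p → ℝ} (hp : 0 < p) (hs : 1 ≤ s)
    (hlam : 0 < lam) (hr : 0 ≤ r) (hrδ : 4 * r ≤ δ) (hδ : δ ≤ lam) (hlams : lam ≤ γ / (8 * s))
    (hcard : (supp θ₀).card ≤ s) (hRE : RestrictedEigenvalue V (supp θ₀) (δ / lam) γ)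
    (hVW : ∀ i j, |W i j - V i j| ≤ r) (hu₀ : ∀ i, |u₀ i| ≤ r)
    (hu : ∀ i, |u i| + lam * l1 θ ≤ r + lam * l1 θ₀)
    (huu : ∀ i, u₀ i - u i = ∑ j, W i j * (θ j - θ₀ j)) :
    (θ - θ₀) ⬝ᵥ (V *ᵥ (θ - θ₀)) ≤ 18 * r ^ 2 / lam := by
  set ν := θ - θ₀ with hν
  set S := supp θ₀ with hS
  set a := ∑ i ∈ S, |ν i| with ha
  set b := ∑ i ∈ Sᶜ, |ν i| with hb
  set Q := ν ⬝ᵥ (V *ᵥ ν) with hQ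
  have ha0 : 0 ≤ a := Finset.sum_nonneg fun i _ => abs_nonneg _
  have hb0 : 0 ≤ b := Finset.sum_nonneg fun i _ => abs_nonneg _
  have hab : l1 ν = a + b := (Finset.sum_add_sum_compl S _).symm
  have hs0 : (0 : ℝ) < s := by exact_mod_cast hs
  have hl1 : l1 θ₀ - l1 θ ≤ a - b := l1_sub_le fun i hi => by simpa [hS, supp] using hi
  have hlamab : lam * (l1 θ₀ - l1 θ) ≤ lam * (a - b) := mul_le_mul_of_nonneg_left hl1 hlam.le
  have hbay : b ≤ a + r / lam := by
    -- Any coordinate serves: dropping its residual leaves `λ (‖θ‖₁ - ‖θ₀‖₁) ≤ r`.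
    have h₁ := hu ⟨0, hp⟩
    have h₂ := abs_nonneg (u ⟨0, hp⟩)
    have h₃ : lam * (b - a) ≤ r := by linarith
    have h₄ : b - a ≤ r / lam := by rwa [le_div_iff₀ hlam, mul_comm]
    linarith
  have hRE' : γ * ∑ i, ν i ^ 2 ≤ Q := by
    refine hRE ν (hbay.trans (add_le_add_right ?_ _))
    exact div_le_div_of_nonneg_right (by linarith) hlam.le
  have ha2 : a ^ 2 ≤ s * ∑ i, ν i ^ 2 := by
    calc a ^ 2 ≤ S.card * ∑ i ∈ S, |ν i| ^ 2 := sq_sum_le_card_mul_sum_sq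
      _ ≤ s * ∑ i, ν i ^ 2 := by
        simp only [sq_abs]
        gcongr
        exact Finset.subset_univ _
  have hQa : 8 * a ^ 2 ≤ Q / lam := by
    rw [le_div_iff₀ hlam]
    rw [le_div_iff₀ (by positivity)] at hlams
    have hN : 0 ≤ ∑ i, ν i ^ 2 := Finset.sum_nonneg fun i _ => sq_nonneg _
    calc 8 * a ^ 2 * lam ≤ 8 * (s * ∑ i, ν i ^ 2) * lam := by gcongr
      _ = lam * (8 * s) * ∑ i, ν i ^ 2 := by ring
      _ ≤ γ * ∑ i, ν i ^ 2 := by gcongr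
      _ ≤ Q := hRE'
  have hQb : Q ≤ (a + b) * (2 * r + lam * (a - b) + r * (a + b)) := by
    rw [← hab]
    refine dotProduct_mulVec_le hVW fun i => ?_
    have h₁ : ∑ j, W i j * ν j = u₀ i - u i := (huu i).symm
    rw [h₁]
    have h₂ := abs_sub (u₀ i) (u i)
    have h₃ := hu i
    have h₄ := hu₀ i
    linarith
  have hfin : Q / lam ≤ 18 * (r / lam) ^ 2 := by
    refine le_of_quadratic_bound ha0 hb0 (by positivity) ?_ hbay hQa ?_
    · rw [div_le_iff₀ hlam]; linarith
    · rw [div_le_iff₀ hlam]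
      refine hQb.trans (le_of_eq ?_)
      field_simp
  rw [div_le_iff₀ hlam] at hfin
  refine hfin.trans (le_of_eq ?_)
  field_simp

end Deterministic

/-! ### The squared distance as a quadratic form in `V`. -/

section Population

variable {𝒵 : Type*} [MeasurableSpace 𝒵] {p : ℕ}

lemma integral_sq_linFun_sub {μ : Measure 𝒵} {X : 𝒵 → Fin p → ℝ}
    (hint : ∀ i j, Integrable (fun z => X z i * X z j) μ) (θ θ' : Fin p → ℝ) :
    ∫ z, (linFun θ (X z) - linFun θ' (X z)) ^ 2 ∂μ
      = (θ - θ') ⬝ᵥ (covMatrix μ X *ᵥ (θ - θ')) := by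
  have h : ∀ z, (linFun θ (X z) - linFun θ' (X z)) ^ 2
      = ∑ i, ∑ j, (θ - θ') i * ((X z i * X z j) * (θ - θ') j) := by
    intro z
    rw [linFun, linFun, ← sub_dotProduct, sq, dotProduct, Finset.sum_mul_sum]
    exact Finset.sum_congr rfl fun i _ => Finset.sum_congr rfl fun j _ => by ring
  simp only [h]
  rw [integral_finsetSum _ fun i _ => integrable_finsetSum _ fun j _ =>
    ((hint i j).mul_const _).const_mul _]
  refine Finset.sum_congr rfl fun i _ => ?_
  rw [integral_finsetSum _ fun j _ => ((hint i j).mul_const _).const_mul _]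
  simp only [integral_const_mul, integral_mul_const, Matrix.mulVec, dotProduct, Finset.mul_sum,
    covMatrix, Matrix.of_apply]

lemma linFun_single (i : Fin p) : linFun (Pi.single i 1) = fun x : Fin p → ℝ => x i := by
  funext x; simp [linFun]

end Population

/-! ### Numerical constants. -/

lemma log_const_mul_div_le {x : ℝ} (hx : 2 ≤ x) :
    0 ≤ Real.log (4 * x) ∧ Real.log (4 * x) ≤ 3 * Real.log x := by
  refine ⟨Real.log_nonneg (by linarith), ?_⟩
  rw [← Real.log_rpow (by linarith)]
  -- `4x ≤ x³` for `x ≥ 2`; with `x = p/ζ` this is where `2ζ ≤ p` matters.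
  refine Real.log_le_log (by linarith) ?_
  norm_cast
  nlinarith [mul_nonneg (sub_nonneg.2 hx) (by linarith : 0 ≤ x)]

/-- The union bound over `p + p²` functions, at the deviation level `4 √(log(4p/ζ)/n)`. -/
lemma union_bound_le {n p : ℕ} {ζ : ℝ} (hn : 1 ≤ n) (hp : 1 ≤ p) (hζ : 0 < ζ) (hζ1 : ζ < 1) :
    ((p + p * p : ℕ) : ℝ)
      * (2 * Real.exp (-(n * (4 * √(Real.log (4 * p / ζ) / n)) ^ 2 / 8))) ≤ ζ := by
  have hn0 : (0 : ℝ) < n := by exact_mod_cast hn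
  have hp1 : (1 : ℝ) ≤ p := by exact_mod_cast hp
  have hx1 : 1 ≤ 4 * p / ζ := by rw [le_div_iff₀ hζ]; linarith
  have hx0 : 0 < 4 * p / ζ := by linarith
  have hL : 0 ≤ Real.log (4 * p / ζ) / n := div_nonneg (Real.log_nonneg hx1) hn0.le
  have hexp : Real.exp (-(n * (4 * √(Real.log (4 * p / ζ) / n)) ^ 2 / 8))
      = ζ ^ 2 / (16 * p ^ 2) := by
    rw [mul_pow, Real.sq_sqrt hL]
    have : -(n * (4 ^ 2 * (Real.log (4 * p / ζ) / n)) / 8) = -(2 * Real.log (4 * p / ζ)) := by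
      field_simp; ring
    rw [this, Real.exp_neg, two_mul, Real.exp_add, Real.exp_log hx0]
    field_simp
    norm_num
  rw [hexp]
  push_cast
  have h₁ : (p + p * p : ℝ) ≤ 2 * p ^ 2 := by nlinarith
  calc (p + p * p : ℝ) * (2 * (ζ ^ 2 / (16 * p ^ 2)))
      ≤ (2 * p ^ 2) * (2 * (ζ ^ 2 / (16 * p ^ 2))) := by gcongr
    _ = ζ ^ 2 / 4 := by field_simp; norm_num
    _ ≤ ζ := by nlinarith

/-- The deterministic rate `18 r² / λ` at `r = 4 √(log(4p/ζ)/n)` is dominated by the claimed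
bound. -/
lemma sqrt_le_rate {n p s : ℕ} {ζ γ lam A Q : ℝ} (hn : 1 ≤ n) (hs : 1 ≤ s) (hζ : 0 < ζ)
    (hp : 2 * ζ ≤ p) (hγ : 0 < γ) (hlam : 0 < lam) (hlams : lam ≤ γ / (8 * s)) (hA : 0 ≤ A)
    (hQ : Q ≤ 18 * (4 * √(Real.log (4 * p / ζ) / n)) ^ 2 / lam) :
    √Q ≤ 20 * (max 1 (1 / lam * (γ / s)) * √(s / γ) * (A + √(Real.log (p / ζ) / n))) := by
  have hn0 : (0 : ℝ) < n := by exact_mod_cast hn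
  have hs0 : (0 : ℝ) < s := by exact_mod_cast hs
  obtain ⟨hlog0, hlog⟩ := log_const_mul_div_le (x := p / ζ) (by rwa [le_div_iff₀ hζ])
  rw [← mul_div_assoc] at hlog0 hlog
  set l := Real.log (p / ζ) with hl
  have hl0 : 0 ≤ l := by linarith
  have hκ : 8 * lam ≤ γ / s := by
    rw [le_div_iff₀ (by positivity)] at hlams ⊢
    linarith
  set κ := γ / s with hκdef
  have hκ0 : 0 < κ := by positivity
  have hsκ : (s : ℝ) / γ = 1 / κ := by rw [hκdef, one_div_div]
  -- Only the second entry of the maximum and the `p/ζ` term are kept. With `κ = γ/s` the prefactor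
  -- is `√κ/λ`, and `κ ≥ 8λ` makes it at least a multiple of `1/√λ`.
  have hbase : 20 * (1 / lam * κ * √(s / γ) * √(l / n))
      ≤ 20 * (max 1 (1 / lam * κ) * √(s / γ) * (A + √(l / n))) := by
    gcongr
    · exact le_max_right _ _
    · linarith
  refine le_trans (Real.sqrt_le_iff.2 ⟨by positivity, ?_⟩) hbase
  rw [mul_pow, mul_pow, mul_pow, Real.sq_sqrt (by positivity), Real.sq_sqrt (by positivity), hsκ]
  rw [mul_pow 4, Real.sq_sqrt (div_nonneg hlog0 hn0.le)] at hQ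
  calc Q ≤ 18 * (4 ^ 2 * (Real.log (4 * p / ζ) / n)) / lam := hQ
    _ ≤ 18 * (4 ^ 2 * (3 * l / n)) / lam := by gcongr
    _ ≤ 400 * (8 * lam) * l / (n * lam ^ 2) := by
        rw [div_le_div_iff₀ hlam (by positivity)]
        have : 18 * (4 ^ 2 * (3 * l / n)) * (n * lam ^ 2) = 864 * (l * lam ^ 2) := by
          field_simp; ring
        rw [this]
        nlinarith [mul_nonneg hl0 (sq_nonneg lam)]
    _ ≤ 400 * κ * l / (n * lam ^ 2) := by gcongr
    _ = 20 ^ 2 * ((1 / lam * κ) ^ 2 * (1 / κ) * (l / n)) := by field_simp; ring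

end AdversarialRiesz

/-! ### Assembly. -/

theorem mainTheorem4 :
    ∃ c₀ c₁ C : ℝ, 0 < c₀ ∧ 0 < c₁ ∧ 0 < C ∧
      ∀ (𝒵 : Type*) [MeasurableSpace 𝒵] (μ : Measure 𝒵) [IsProbabilityMeasure μ]
        (Ω : Type*) [MeasurableSpace Ω] (P : Measure Ω) [IsProbabilityMeasure P]
        (n p s : ℕ) (ζ γ lam : ℝ)
        (X : 𝒵 → Fin p → ℝ) (m : 𝒵 → ((Fin p → ℝ) → ℝ) →ₗ[ℝ] ℝ) (θ₀ : Fin p → ℝ)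
        (Z : Fin n → Ω → 𝒵) (θhat : Ω → Fin p → ℝ),
        1 ≤ n → 1 ≤ s → 0 < ζ → ζ < 1 → 2 * ζ ≤ p → 0 < γ → 0 < lam →
        -- `Z₁, …, Zₙ` are i.i.d. with law `μ`
        (∀ k, Measurable (Z k)) → (∀ k, P.map (Z k) = μ) → iIndepFun Z P →
        -- measurability, and boundedness in `[-1, 1]` of `𝓕`, `m ∘ 𝓕` and `a₀`
        Measurable X → (∀ f ∈ AdversarialRiesz.testClass p, Measurable fun z => m z f) →
        (∀ f ∈ AdversarialRiesz.testClass p, ∀ᵐ z ∂μ, |f (X z)| ≤ 1) →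
        (∀ f ∈ AdversarialRiesz.testClass p, ∀ᵐ z ∂μ, |m z f| ≤ 1) →
        (∀ᵐ z ∂μ, |AdversarialRiesz.linFun θ₀ (X z)| ≤ 1) →
        -- `a₀ = ⟨θ₀, ·⟩` is the Riesz representer of `g ↦ 𝔼[m(Z; g)]`, and is `s`-sparse
        (∀ θ : Fin p → ℝ, ∫ z, m z (AdversarialRiesz.linFun θ) ∂μ
          = ∫ z, AdversarialRiesz.linFun θ₀ (X z) * AdversarialRiesz.linFun θ (X z) ∂μ) →
        (AdversarialRiesz.supp θ₀).card ≤ s →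
        -- restricted eigenvalue condition and range of the penalty level
        AdversarialRiesz.RestrictedEigenvalue (AdversarialRiesz.covMatrix μ X)
          (AdversarialRiesz.supp θ₀) (AdversarialRiesz.delta c₀ c₁ μ X m n ζ / lam) γ →
        AdversarialRiesz.delta c₀ c₁ μ X m n ζ ≤ lam → lam ≤ γ / (8 * s) →
        -- `â = ⟨θhat, ·⟩` is any minimizer of the penalized empirical criterion
        (∀ᵐ ω ∂P, AdversarialRiesz.IsEstimate X m lam (fun k => Z k ω) (θhat ω)) →
        P {ω | ¬ AdversarialRiesz.l2Dist μ X (θhat ω) θ₀ ≤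
          C * (max 1 (1 / lam * (γ / s)) * √(s / γ)
            * ((AdversarialRiesz.l1 θ₀ + 1) * √(Real.log p / n) + √(Real.log (p / ζ) / n)))}
          ≤ ENNReal.ofReal ζ := by
  -- `c₁ = 4` closes the union bound; `c₀ = 16` gives `4r ≤ δ`, hence `r/λ ≤ 1/4`.
  refine ⟨16, 4, 20, by norm_num, by norm_num, by norm_num, ?_⟩
  intro 𝒵 _ μ _ Ω _ P _ n p s ζ γ lam X m θ₀ Z θhat hn hs hζ hζ1 hp hγ hlam hZ hmap hind hX hm
    hfb hmb ha₀ hriesz hcard hRE hδ hlams hest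
  have hp0 : 0 < p := by
    rcases Nat.eq_zero_or_pos p with rfl | h
    · norm_num at hp; linarith
    · exact h
  set r : ℝ := 4 * √(Real.log (4 * p / ζ) / n) with hr
  have hr0 : 0 ≤ r := by positivity
  have hrδ : 4 * r ≤ AdversarialRiesz.delta 16 4 μ X m n ζ :=
    le_trans (le_of_eq (by rw [hr]; ring)) (AdversarialRiesz.le_delta μ X m n ζ)
  have hXm : ∀ i, Measurable fun z => X z i := fun i => (measurable_pi_apply i).comp hX
  have hXb : ∀ i, ∀ᵐ z ∂μ, |X z i| ≤ 1 := fun i =>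
    hfb _ (AdversarialRiesz.coord_mem_testClass i)
  have hMm : ∀ i, Measurable fun z => m z (fun x => x i) := fun i =>
    hm _ (AdversarialRiesz.coord_mem_testClass i)
  have hMb : ∀ i, ∀ᵐ z ∂μ, |m z (fun x => x i)| ≤ 1 := fun i =>
    hmb _ (AdversarialRiesz.coord_mem_testClass i)
  have ha₀m : Measurable fun z => AdversarialRiesz.linFun θ₀ (X z) := by
    simp only [AdversarialRiesz.linFun, dotProduct]
    exact Finset.measurable_sum _ fun i _ => (hXm i).const_mul _
  have haXb : ∀ i, ∀ᵐ z ∂μ, |AdversarialRiesz.linFun θ₀ (X z) * X z i| ≤ 1 := by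
    intro i
    filter_upwards [ha₀, hXb i] with z h₁ h₂
    rw [abs_mul]
    exact mul_le_one₀ h₁ (abs_nonneg _) h₂
  have hXXb : ∀ i j, ∀ᵐ z ∂μ, |X z i * X z j| ≤ 1 := by
    intro i j
    filter_upwards [hXb i, hXb j] with z h₁ h₂
    rw [abs_mul]
    exact mul_le_one₀ h₁ (abs_nonneg _) h₂
  have haXint : ∀ i, Integrable (fun z => AdversarialRiesz.linFun θ₀ (X z) * X z i) μ := fun i =>
    Integrable.of_bound (ha₀m.mul (hXm i)).aestronglyMeasurable 1 (haXb i)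
  have hmean : ∀ i,
      ∫ z, (m z (fun x => x i) - AdversarialRiesz.linFun θ₀ (X z) * X z i) ∂μ = 0 := by
    intro i
    rw [integral_sub (Integrable.of_bound (hMm i).aestronglyMeasurable 1 (hMb i)) (haXint i)]
    have h := hriesz (Pi.single i 1)
    rw [AdversarialRiesz.linFun_single] at h
    rw [h, sub_self]
  let g : Fin p ⊕ Fin p × Fin p → 𝒵 → ℝ := Sum.elim
    (fun i z => m z (fun x => x i) - AdversarialRiesz.linFun θ₀ (X z) * X z i)
    (fun ij z => X z ij.1 * X z ij.2)
  have hg : ∀ i, Measurable (g i) := by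
    rintro (i | ⟨i, j⟩)
    · exact (hMm i).sub (ha₀m.mul (hXm i))
    · exact (hXm i).mul (hXm j)
  have hgb : ∀ i, ∀ᵐ z ∂μ, |g i z| ≤ 2 := by
    rintro (i | ⟨i, j⟩)
    · filter_upwards [hMb i, haXb i] with z h₁ h₂
      exact (abs_sub _ _).trans (by linarith)
    · filter_upwards [hXXb i j] with z h
      exact le_trans h one_le_two
  have hdev := AdversarialRiesz.measureReal_exists_le_abs_sub_integral_le hn hZ hmap hind hg hgb hr0
  have hcard_eq : Fintype.card (Fin p ⊕ Fin p × Fin p) = p + p * p := by simp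
  rw [hcard_eq] at hdev
  have hprob := hdev.trans (AdversarialRiesz.union_bound_le hn hp0 hζ hζ1)
  -- Almost-sure inclusion of the failure set in the deviation event suffices, so `θhat` need not be
  -- measurable.
  refine le_trans (measure_mono_ae ?_)
    ((ENNReal.le_ofReal_iff_toReal_le (measure_ne_top _ _) hζ.le).2 hprob)
  filter_upwards [hest] with ω hω hbad
  by_contra hgood
  refine hbad ?_
  have hclose : ∀ i, |(1 / (n : ℝ)) * ∑ k, g i (Z k ω) - ∫ z, g i z ∂μ| ≤ r := fun i =>
    le_of_not_ge fun h => hgood ⟨i, h⟩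
  have hres : ∀ i, |AdversarialRiesz.residual X m (fun k => Z k ω) θ₀ i| ≤ r := by
    intro i
    have h := hclose (Sum.inl i)
    simp only [g, Sum.elim_inl, hmean i, sub_zero] at h
    exact h
  refine AdversarialRiesz.sqrt_le_rate hn hs hζ hp hγ hlam hlams
    (mul_nonneg (add_nonneg (Finset.sum_nonneg fun i _ => abs_nonneg _) zero_le_one)
      (Real.sqrt_nonneg _)) ?_
  rw [AdversarialRiesz.integral_sq_linFun_sub fun i j => Integrable.of_bound
    ((hXm i).mul (hXm j)).aestronglyMeasurable 1 (hXXb i j)]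
  refine AdversarialRiesz.dotProduct_mulVec_le_of_close
    (W := Matrix.of fun i j => 1 / (n : ℝ) * ∑ k, X (Z k ω) i * X (Z k ω) j)
    hp0 hs hlam hr0 hrδ hδ hlams hcard hRE (fun i j => hclose (Sum.inr (i, j))) hres
    (fun i => (AdversarialRiesz.abs_residual_add_le_criterion X m lam _ _ i).trans
      ((hω θ₀).trans (AdversarialRiesz.criterion_le X m lam _ θ₀ hr0 hres)))
    (fun i => AdversarialRiesz.residual_sub_residual X m _ _ _ i)
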